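/- Let $d\ge 2$ be an integer, let $c\in\mathbb{C}$, and let $f:\mathbb{C}\to\mathbb{C}$, $f(z)=z^d+c$. An attracting cycle of $f$ is the orbit $O=\{f^k(p):k\ge 0\}$ of a point $p\in\mathbb{C}$ with $f^m(p)=p$ and $|Df^m(p)|<1$ for some $m\ge 1$; its basin is the set of all $z\in\mathbb{C}$ with $\operatorname{dist}(f^k(z),O)\to 0$ as $k\to\infty$. Assume that the critical value $c$ does not belong to the basin of any attracting cycle of $f$. Then $$\chi_-(f,c)=\liminf_{n\to\infty}\frac1n\log|Df^n(c)|\ge 0,$$ where the lower limit is taken in $[-\infty,+\infty]$ and $\log 0=-\infty$. -/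

import Mathlib

open Filter Topology

/-- The unicritical polynomial map `z ↦ z ^ d + c` of the complex plane; its critical value is `c`. -/
def unicritical (d : ℕ) (c : ℂ) : ℂ → ℂ := fun z => z ^ d + c

/-- `O` is an attracting cycle of `f` in the plane: the orbit of a periodic point `p` (of some
period `m ≥ 1`) whose multiplier `D(f^m)(p)` has absolute value less than one (the superattracting
case, multiplier zero, included). -/
def IsAttractingCycle (f : ℂ → ℂ) (O : Set ℂ) : Prop :=
  ∃ (p : ℂ) (m : ℕ), 0 < m ∧ Function.IsPeriodicPt f m p ∧ ‖deriv f^[m] p‖ < 1 ∧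
    O = Set.range (fun k : ℕ => f^[k] p)

/-- The basin of a cycle `O`: the set of points whose forward orbit converges to `O`. -/
def basin (f : ℂ → ℂ) (O : Set ℂ) : Set ℂ :=
  {z | Tendsto (fun k : ℕ => Metric.infDist (f^[k] z) O) atTop (𝓝 0)}

/-- The lower Lyapunov exponent `liminf (1 / n) log |Df^n(z)|`, with values in `[-∞, +∞]`
and with `log 0 = -∞`. -/
noncomputable def lowerLyapunovExponent (f : ℂ → ℂ) (z : ℂ) : EReal :=
  liminf (fun n : ℕ => (((1 : ℝ) / (n : ℝ) : ℝ) : EReal) * ENNReal.log ‖deriv f^[n] z‖ₑ) atTop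

/-! If the critical orbit `x j` is unbounded, it escapes and `|Df^n(c)|` stays bounded below.
Suppose it is bounded, and let `τ = (1 + η) ^ (d - 1)`. A disc about `x i` whose size stays below
`η` times the distance to the critical point `0` is stretched by at most `τ` times the derivative at
each step. If some iterate mapped it into itself as a contraction, Banach's theorem would give an
attracting cycle whose basin contains `c`. Hence a small disc that shrinks cannot return close to
its centre: this is `lt_norm_sub`, stated with weight `τ ^ 2` per step so that the second `τ` makes
the contraction strict.

Two consequences give the lower bound. Centres of discs that keep shrinking are uniformly separated,
so by compactness there are boundedly many of them. On a stretch ending at a closest approach to `0`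
and starting near `c` at the corresponding scale, backward induction (`le_growth_of_min`) shows that
the weighted derivative loses at most one factor `η / 4` per visit to the `δ`-disc, up to a
constant. Cutting the orbit at successive closest approaches multiplies these bounds.

Since `0` is not periodic, visits to a small disc have arbitrarily small frequency, so the losses
amount to at most `τ ^ (2 * n)` up to a constant. Removing the weights gives `|Df^n(c)| ≥ C * τ⁻¹ ^
(4 * n)`, and `η → 0` finishes. -/

/-! ### Counting visits -/

/-- The number of indices in `[i, n)` that satisfy `P`. -/
noncomputable def countIco (P : ℕ → Prop) (i n : ℕ) : ℕ := by
  classical exact ((Finset.Ico i n).filter P).card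

lemma countIco_anti (P : ℕ → Prop) {i j n : ℕ} (h : i ≤ j) :
    countIco P j n ≤ countIco P i n := by
  classical
  unfold countIco
  exact Finset.card_le_card (Finset.filter_subset_filter _ (Finset.Ico_subset_Ico_left h))

lemma countIco_split (P : ℕ → Prop) {i j n : ℕ} (h : i ≤ j) (h' : j ≤ n) :
    countIco P i n = countIco P i j + countIco P j n := by
  classical
  unfold countIco
  rw [← Finset.Ico_union_Ico_eq_Ico h h', Finset.filter_union, Finset.card_union_of_disjoint]
  exact Finset.disjoint_filter_filter (Finset.Ico_disjoint_Ico_consecutive i j n)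

lemma countIco_succ (P : ℕ → Prop) {i j n : ℕ} (h : i ≤ j) (h' : j < n) (hP : P j) :
    countIco P (j + 1) n + 1 ≤ countIco P i n := by
  have h1 : countIco P j (j + 1) = 1 := by
    classical
    unfold countIco
    rw [Nat.Ico_succ_singleton, Finset.filter_singleton, if_pos hP, Finset.card_singleton]
  have h2 := countIco_split P (Nat.le_succ j) h'
  have h3 := countIco_anti P (n := n) h
  simp only [Nat.succ_eq_add_one] at h2
  omega

/-- Each block of length `N` contains at most one index satisfying `P`. -/
lemma countIco_le_of_gap (P : ℕ → Prop) {N : ℕ} (hN : 0 < N)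
    (h : ∀ i l, P i → 0 < l → l < N → ¬ P (i + l)) (n : ℕ) :
    countIco P 0 n ≤ n / N + 1 := by
  classical
  unfold countIco
  rw [← Finset.card_range (n / N + 1)]
  refine Finset.card_le_card_of_injOn (fun j => j / N) ?_ ?_
  · intro j hj
    simp only [Finset.coe_filter, Finset.mem_Ico, Set.mem_ofPred_eq] at hj
    simp only [Finset.coe_range, Set.mem_Iio]
    exact Nat.lt_succ_of_le (Nat.div_le_div_right hj.1.2.le)
  · have key : ∀ i j, P i → P j → i / N = j / N → ¬ i < j := by
      intro i j hi hj hij hlt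
      have h1 := Nat.div_add_mod i N
      have h2 := Nat.div_add_mod j N
      have h3 := Nat.mod_lt j hN
      rw [hij] at h1
      refine h i (j - i) hi (by omega) (by omega) ?_
      rwa [Nat.add_sub_cancel' hlt.le]
    intro i hi j hj hij
    simp only [Finset.coe_filter, Set.mem_ofPred_eq] at hi hj
    exact le_antisymm (not_lt.1 (key j i hj.2 hi.2 hij.symm)) (not_lt.1 (key i j hi.2 hj.2 hij))

/-- A finite cover by balls of radius `r / 2` puts at most one selected point in each ball; the
bound depends on neither `P` nor `n`. -/
lemma exists_countIco_le_of_separated {x : ℕ → ℂ} {K : ℝ} (hK : ∀ j, ‖x j‖ ≤ K) {r : ℝ}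
    (hr : 0 < r) : ∃ p : ℕ, ∀ (P : ℕ → Prop) (n : ℕ),
      (∀ i j, i < j → P i → P j → j < n → r < ‖x j - x i‖) → ∀ i, countIco P i n ≤ p := by
  classical
  obtain ⟨t, -, htf, ht⟩ := Metric.totallyBounded_iff.1
    (isCompact_closedBall (0 : ℂ) K).totallyBounded (r / 2) (half_pos hr) |>.imp
      fun t h => (⟨trivial, h.1, h.2⟩ : True ∧ _ ∧ _)
  have hmem : ∀ j, ∃ y ∈ htf.toFinset, x j ∈ Metric.ball y (r / 2) := by
    intro j
    have := ht (show x j ∈ Metric.closedBall (0 : ℂ) K by simpa using hK j)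
    simpa using this
  choose g hg hxg using hmem
  refine ⟨htf.toFinset.card, fun P n hP i => ?_⟩
  unfold countIco
  refine Finset.card_le_card_of_injOn g (fun j _ => hg j) ?_
  have key : ∀ a b, P a → P b → b < n → g a = g b → ¬ a < b := by
    intro a b ha hb hbn hab hlt
    have h1 := hxg a
    have h2 := hxg b
    rw [hab] at h1
    rw [Metric.mem_ball] at h1 h2
    have h3 := dist_triangle_right (x b) (x a) (g b)
    have h4 := hP a b hlt ha hb hbn
    rw [← dist_eq_norm] at h4
    linarith
  intro a ha b hb hab
  simp only [Finset.coe_filter, Finset.mem_Ico, Set.mem_ofPred_eq] at ha hb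
  exact le_antisymm (not_lt.1 (key b a hb.2 ha.2 ha.1.2 hab.symm))
    (not_lt.1 (key a b ha.2 hb.2 hb.1.2 hab))

/-! ### Weighted derivatives and orbits without contracting discs -/

/-- The product of `q * (d * ‖x l‖ ^ (d - 1))` over `l ∈ [i, j)`: along an orbit of `z ^ d + c`
it is `q ^ (j - i)` times the modulus of the derivative. -/
noncomputable def growth (d : ℕ) (q : ℝ) (x : ℕ → ℂ) (i j : ℕ) : ℝ :=
  ∏ l ∈ Finset.Ico i j, (q * (d * ‖x l‖ ^ (d - 1)))

section growth

variable {d : ℕ} {q : ℝ} {x : ℕ → ℂ}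

@[simp] lemma growth_self (i : ℕ) : growth d q x i i = 1 := by simp [growth]

lemma growth_mul {i j k : ℕ} (h : i ≤ j) (h' : j ≤ k) :
    growth d q x i j * growth d q x j k = growth d q x i k :=
  Finset.prod_Ico_consecutive _ h h'

lemma growth_succ {i j : ℕ} (h : i ≤ j) :
    growth d q x i (j + 1) = growth d q x i j * (q * (d * ‖x j‖ ^ (d - 1))) :=
  Finset.prod_Ico_succ_top h _

lemma growth_step (i : ℕ) : growth d q x i (i + 1) = q * (d * ‖x i‖ ^ (d - 1)) := by
  rw [growth_succ le_rfl, growth_self, one_mul]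

lemma growth_nonneg (hq : 0 ≤ q) (i j : ℕ) : 0 ≤ growth d q x i j :=
  Finset.prod_nonneg fun _ _ => by positivity

lemma growth_pos (hd : 0 < d) (hq : 0 < q) (hx : ∀ j, x j ≠ 0) (i j : ℕ) :
    0 < growth d q x i j :=
  Finset.prod_pos fun l _ => by have := norm_pos_iff.2 (hx l); positivity

lemma growth_eq_pow_mul (i j : ℕ) :
    growth d q x i j = q ^ (j - i) * growth d 1 x i j := by
  simp only [growth, one_mul]
  rw [Finset.prod_mul_distrib, Finset.prod_const, Nat.card_Ico]

end growth

/-- A sequence of nonzero points with the metric features of the critical orbit of `z ^ d + c`,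
along which no disc is mapped into itself by a contraction. -/
structure NoncontractingOrbit (d : ℕ) (τ η : ℝ) (x : ℕ → ℂ) : Prop where
  degree_pos : 0 < d
  one_lt : 1 < τ
  eta_pos : 0 < η
  eta_le_one : η ≤ 1
  ne_zero : ∀ j, x j ≠ 0
  norm_succ_sub : ∀ j, ‖x (j + 1) - x 0‖ = ‖x j‖ ^ d
  lt_norm_sub : ∀ i j R, i < j → 0 < R →
    (∀ l, i ≤ l → l < j → R * growth d (τ ^ 2) x i l ≤ η * ‖x l‖) →
    growth d (τ ^ 2) x i j ≤ 1 → R * (1 - τ⁻¹ * growth d (τ ^ 2) x i j) < ‖x j - x i‖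

lemma pow_mul_pow_le_pow_mul_pow {κ M : ℝ} (hκ : 0 ≤ κ) (hκ' : κ ≤ 1) (hM : 0 ≤ M) (hM' : M ≤ 1)
    {m m' s s' : ℕ} (hm : m' ≤ m) (hs : s' ≤ s) : κ ^ m * M ^ s ≤ κ ^ m' * M ^ s' :=
  mul_le_mul (pow_le_pow_of_le_one hκ hκ' hm) (pow_le_pow_of_le_one hM hM' hs)
    (by positivity) (by positivity)

namespace NoncontractingOrbit

variable {d : ℕ} {τ η : ℝ} {x : ℕ → ℂ}

/-- The disc of radius `r` about `x l` shrinks up to the time `k` and never reaches a size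
comparable with its distance to the critical point. -/
def Shrinks (d : ℕ) (τ η : ℝ) (x : ℕ → ℂ) (r : ℝ) (k l : ℕ) : Prop :=
  ∀ j, l ≤ j → j ≤ k → growth d (τ ^ 2) x l j ≤ 1 ∧ r * growth d (τ ^ 2) x l j < η * ‖x j‖

lemma Shrinks.lt_norm_sub (h : NoncontractingOrbit d τ η x) {r : ℝ} (hr : 0 < r) {k i j : ℕ}
    (hi : Shrinks d τ η x r k i) (hij : i < j) (hj : j ≤ k) :
    r * (1 - τ⁻¹) < ‖x j - x i‖ := by
  have h1 := h.lt_norm_sub i j r hij hr (fun l hl hl' => (hi l hl (hl'.le.trans hj)).2.le)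
    (hi j hij.le hj).1
  have h2 := (hi j hij.le hj).1
  have h3 : 0 < τ⁻¹ := inv_pos.2 (by linarith [h.one_lt])
  have h4 : τ⁻¹ * growth d (τ ^ 2) x i j ≤ τ⁻¹ := mul_le_of_le_one_right h3.le h2
  nlinarith

lemma one_le_const (h : NoncontractingOrbit d τ η x) : 1 ≤ τ ^ 2 * d := by
  have h1 : (1 : ℝ) ≤ d := by exact_mod_cast h.degree_pos
  have h2 : 1 ≤ τ ^ 2 := one_le_pow₀ h.one_lt.le
  nlinarith

lemma pow_norm_le_growth_step (h : NoncontractingOrbit d τ η x) (i : ℕ) :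
    ‖x i‖ ^ (d - 1) ≤ growth d (τ ^ 2) x i (i + 1) := by
  rw [growth_step, ← mul_assoc]
  exact le_mul_of_one_le_left (by positivity) h.one_le_const

/-- Used when the disc of radius of order `1 / a` has grown to size of order `‖x j‖`: the next step
contributes at least `‖x j‖ ^ (d - 1)`. -/
lemma growth_mul_pow_norm_le (h : NoncontractingOrbit d τ η x) {i j : ℕ} (hij : i ≤ j) {a : ℝ}
    (ha : a * ‖x j‖ ≤ growth d (τ ^ 2) x i j) :
    a * ‖x j‖ ^ d ≤ growth d (τ ^ 2) x i (j + 1) := by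
  rw [← growth_mul hij (Nat.le_succ j)]
  calc a * ‖x j‖ ^ d = a * ‖x j‖ * ‖x j‖ ^ (d - 1) := by
        rw [mul_assoc, ← pow_succ', Nat.sub_add_cancel h.degree_pos]
    _ ≤ _ := mul_le_mul ha (h.pow_norm_le_growth_step j) (by positivity)
        (growth_nonneg (by positivity) _ _)

/-- Backward induction on `i`, proving two bounds together: one for `x i` in the image of the disc
of radius `t` about `0`, one for arbitrary `x i`. Follow a disc about `x i`, of radius `4 * t ^ d`
or `η * δ` respectively. Either it becomes large, or it becomes comparable with its distance to `0`,
or neither happens up to time `k`; the first two cases pass to a later starting time. -/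
lemma le_growth_of_min (h : NoncontractingOrbit d τ η x) {δ : ℝ} (hδ : 0 < δ) (hδ1 : δ ≤ 1)
    (hδη : 4 * δ ^ (d - 1) ≤ η) {k : ℕ} (hk : ‖x k‖ ≤ δ) (a : ℕ)
    (hmin : ∀ j, a ≤ j → j ≤ k → ‖x k‖ ≤ ‖x j‖) (n : ℕ) :
    ∀ i, a ≤ i → i + n = k →
      (∀ t, ‖x k‖ ≤ t → t ≤ δ → ‖x i - x 0‖ ≤ t ^ d →
        (η / 4) ^ (countIco (fun j => ‖x j‖ ≤ δ) i (k + 1) + 1) *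
          (δ ^ (d - 1)) ^ (countIco (Shrinks d τ η x (η * δ) k) i (k + 1)) * (‖x k‖ / t) ^ d
          ≤ growth d (τ ^ 2) x i (k + 1)) ∧
      (η / 4) ^ (countIco (fun j => ‖x j‖ ≤ δ) i (k + 1)) *
          (δ ^ (d - 1)) ^ (countIco (Shrinks d τ η x (η * δ) k) i (k + 1)) * (‖x k‖ ^ d / δ)
          ≤ growth d (τ ^ 2) x i (k + 1) := by
  set κ := η / 4 with hκ
  set M := δ ^ (d - 1) with hM
  set m := fun i => countIco (fun j => ‖x j‖ ≤ δ) i (k + 1) with hm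
  set s := fun i => countIco (Shrinks d τ η x (η * δ) k) i (k + 1) with hs
  have hη := h.eta_pos
  have hη1 := h.eta_le_one
  have hτ : 0 < τ := by linarith [h.one_lt]
  have hκ0 : 0 < κ := by positivity
  have hκ1 : κ ≤ 1 := by linarith
  have hM0 : 0 < M := by positivity
  have hM1 : M ≤ 1 := pow_le_one₀ hδ.le hδ1
  have hw : 0 < ‖x k‖ := norm_pos_iff.2 (h.ne_zero k)
  have hmono : ∀ {m m' s s' : ℕ}, m' ≤ m → s' ≤ s → κ ^ m * M ^ s ≤ κ ^ m' * M ^ s' :=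
    fun h1 h2 => pow_mul_pow_le_pow_mul_pow hκ0.le hκ1 hM0.le hM1 h1 h2
  have hG0 : ∀ i j, 0 < growth d (τ ^ 2) x i j :=
    growth_pos h.degree_pos (by positivity) h.ne_zero
  have hle_one : ∀ {m s : ℕ}, κ ^ m * M ^ s ≤ 1 := fun {m s} => by
    simpa using hmono (Nat.zero_le m) (Nat.zero_le s)
  -- reaching a point `x j` near the critical point with the disc comparable to `‖x j‖`
  have hit : ∀ i j b, i ≤ j → j ≤ k → a ≤ j → 0 < b → ‖x j‖ ≤ δ →
      b * ‖x j‖ ≤ growth d (τ ^ 2) x i j →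
      (∀ i', a ≤ i' → i < i' → i' ≤ k → ∀ t, ‖x k‖ ≤ t → t ≤ δ → ‖x i' - x 0‖ ≤ t ^ d →
        κ ^ (m i' + 1) * M ^ (s i') * (‖x k‖ / t) ^ d ≤ growth d (τ ^ 2) x i' (k + 1)) →
      κ ^ (m i) * M ^ (s i) * (b * ‖x k‖ ^ d) ≤ growth d (τ ^ 2) x i (k + 1) := by
    intro i j b hij hjk haj hb hj hbj ih
    have h1 := h.growth_mul_pow_norm_le hij hbj
    have hxj : 0 < ‖x j‖ := norm_pos_iff.2 (h.ne_zero j)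
    rcases hjk.eq_or_lt with rfl | hlt
    · refine le_trans ?_ h1
      exact mul_le_of_le_one_left (by positivity) hle_one
    -- Restart just after the near approach with `t = ‖x j‖`; the factors `‖x j‖ ^ d` gained and
    -- lost cancel.
    · have h2 := ih (j + 1) (by omega) (by omega) hlt ‖x j‖ (hmin j haj hjk) hj
        (h.norm_succ_sub j).le
      rw [← growth_mul (show i ≤ j + 1 by omega) (show j + 1 ≤ k + 1 by omega)]
      calc κ ^ (m i) * M ^ (s i) * (b * ‖x k‖ ^ d)
          ≤ κ ^ (m (j + 1) + 1) * M ^ (s (j + 1)) * (b * ‖x k‖ ^ d) := by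
            refine mul_le_mul_of_nonneg_right (hmono ?_ ?_) (by positivity)
            · exact countIco_succ _ hij (by omega) hj
            · exact countIco_anti _ (by omega)
        _ = (b * ‖x j‖ ^ d) * (κ ^ (m (j + 1) + 1) * M ^ (s (j + 1)) * (‖x k‖ / ‖x j‖) ^ d) := by
            rw [div_pow ‖x k‖]; field_simp
        _ ≤ _ := mul_le_mul h1 h2 (by positivity) (hG0 _ _).le
  induction n using Nat.strong_induction_on with
  | _ n ih =>
  intro i hai hin
  have ih1 : ∀ i', a ≤ i' → i < i' → i' ≤ k → ∀ t, ‖x k‖ ≤ t → t ≤ δ → ‖x i' - x 0‖ ≤ t ^ d →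
      κ ^ (m i' + 1) * M ^ (s i') * (‖x k‖ / t) ^ d ≤ growth d (τ ^ 2) x i' (k + 1) :=
    fun i' h1 h2 h3 => (ih (k - i') (by omega) i' h1 (by omega)).1
  have ih2 : ∀ i', a ≤ i' → i < i' → i' ≤ k →
      κ ^ (m i') * M ^ (s i') * (‖x k‖ ^ d / δ) ≤ growth d (τ ^ 2) x i' (k + 1) :=
    fun i' h1 h2 h3 => (ih (k - i') (by omega) i' h1 (by omega)).2
  constructor
  · intro t hwt htδ hit0
    have ht : 0 < t := hw.trans_le hwt
    have hR : 4 * t ^ d ≤ η * δ := by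
      calc 4 * t ^ d ≤ 4 * δ ^ d := by gcongr
        _ = 4 * δ ^ (d - 1) * δ := by
          rw [mul_assoc, ← pow_succ, Nat.sub_add_cancel h.degree_pos]
        _ ≤ η * δ := by gcongr
    -- The disc reaches size `η * δ`: continue from `j` with the second bound.
    by_cases hcap : ∃ j, i < j ∧ j ≤ k ∧ η * δ ≤ 4 * t ^ d * growth d (τ ^ 2) x i j
    · obtain ⟨j, hij, hjk, hj⟩ := hcap
      rw [← growth_mul hij.le (show j ≤ k + 1 by omega)]
      calc κ ^ (m i + 1) * M ^ (s i) * (‖x k‖ / t) ^ d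
          = κ ^ (m i) * M ^ (s i) * (κ * (‖x k‖ / t) ^ d) := by ring
        _ ≤ κ ^ (m j) * M ^ (s j) * (κ * (‖x k‖ / t) ^ d) := by
            refine mul_le_mul_of_nonneg_right (hmono ?_ ?_) (by positivity)
            · exact countIco_anti _ hij.le
            · exact countIco_anti _ hij.le
        _ = (η * δ / (4 * t ^ d)) * (κ ^ (m j) * M ^ (s j) * (‖x k‖ ^ d / δ)) := by
            rw [hκ, div_pow ‖x k‖]; field_simp
        _ ≤ _ := by
            refine mul_le_mul ?_ (ih2 j (by omega) hij hjk) (by positivity) (hG0 _ _).le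
            rw [div_le_iff₀ (by positivity)]
            linarith
    have hcap' : ∀ j, i ≤ j → j ≤ k → 4 * t ^ d * growth d (τ ^ 2) x i j ≤ η * δ := by
      intro j hij hjk
      rcases hij.eq_or_lt with rfl | hlt
      · simpa using hR
      · by_contra hc
        exact hcap ⟨j, hlt, hjk, (not_le.1 hc).le⟩
    by_cases hhit : ∃ j, i ≤ j ∧ j ≤ k ∧ η * ‖x j‖ ≤ 4 * t ^ d * growth d (τ ^ 2) x i j
    · obtain ⟨j, hij, hjk, hj⟩ := hhit
      have hxδ : ‖x j‖ ≤ δ := le_of_mul_le_mul_left (hj.trans (hcap' j hij hjk)) hη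
      have := hit i j (κ / t ^ d) hij hjk (by omega) (by positivity) hxδ (by
        rw [div_mul_eq_mul_div, div_le_iff₀ (by positivity), hκ]
        linarith) ih1
      calc κ ^ (m i + 1) * M ^ (s i) * (‖x k‖ / t) ^ d = κ ^ (m i) * M ^ (s i) * (κ / t ^ d * ‖x k‖ ^ d) := by
            rw [div_pow ‖x k‖]; ring
        _ ≤ _ := this
    · push Not at hhit
      -- Both `x i` and `x (k + 1)` lie within `t ^ d` of `x 0`. With derivative below `1 / 2`, the
      -- disc of radius `4 * t ^ d` would return into itself; this fixes the constant `4`.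
      have hhalf : 1 / 2 ≤ growth d (τ ^ 2) x i (k + 1) := by
        by_contra hc
        push Not at hc
        have h1 := h.lt_norm_sub i (k + 1) (4 * t ^ d) (by omega) (by positivity)
          (fun l h1 h2 => (hhit l h1 (by omega)).le) (by linarith)
        have h2 : ‖x (k + 1) - x i‖ ≤ 2 * t ^ d := by
          have h3 : ‖x (k + 1) - x 0‖ ≤ t ^ d := by
            rw [h.norm_succ_sub]; gcongr
          have h4 := norm_sub_le (x (k + 1) - x 0) (x i - x 0)
          rw [sub_sub_sub_cancel_right] at h4
          linarith
        have h3 : τ⁻¹ * growth d (τ ^ 2) x i (k + 1) ≤ 1 / 2 := by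
          have := mul_le_of_le_one_left (hG0 i (k + 1)).le (inv_le_one_of_one_le₀ h.one_lt.le)
          linarith
        have h4 : 0 < t ^ d := by positivity
        nlinarith
      refine le_trans ?_ hhalf
      have h1 : (‖x k‖ / t) ^ d ≤ 1 := pow_le_one₀ (by positivity) ((div_le_one ht).2 hwt)
      calc _ = (κ ^ (m i) * M ^ (s i)) * κ * (‖x k‖ / t) ^ d := by ring
        _ ≤ 1 * κ * 1 := by gcongr; exact hle_one
        _ ≤ 1 / 2 := by linarith
  · by_cases hcap : ∃ j, i < j ∧ j ≤ k ∧ 1 < growth d (τ ^ 2) x i j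
    · obtain ⟨j, hij, hjk, hj⟩ := hcap
      rw [← growth_mul hij.le (show j ≤ k + 1 by omega)]
      refine le_trans ?_ (le_mul_of_one_le_left (hG0 _ _).le hj.le)
      refine le_trans ?_ (ih2 j (by omega) hij hjk)
      refine mul_le_mul_of_nonneg_right (hmono ?_ ?_) (by positivity)
      · exact countIco_anti _ hij.le
      · exact countIco_anti _ hij.le
    have hcap' : ∀ j, i ≤ j → j ≤ k → growth d (τ ^ 2) x i j ≤ 1 := by
      intro j hij hjk
      rcases hij.eq_or_lt with rfl | hlt
      · simp
      · by_contra hc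
        exact hcap ⟨j, hlt, hjk, not_le.1 hc⟩
    by_cases hhit : ∃ j, i ≤ j ∧ j ≤ k ∧ η * ‖x j‖ ≤ η * δ * growth d (τ ^ 2) x i j
    · obtain ⟨j, hij, hjk, hj⟩ := hhit
      rw [mul_assoc] at hj
      have hj' : ‖x j‖ ≤ δ * growth d (τ ^ 2) x i j := le_of_mul_le_mul_left hj hη
      have hxδ : ‖x j‖ ≤ δ := hj'.trans (mul_le_of_le_one_right hδ.le (hcap' j hij hjk))
      have := hit i j δ⁻¹ hij hjk (by omega) (by positivity) hxδ (by
        rw [inv_mul_le_iff₀ hδ]; exact hj') ih1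
      calc _ = κ ^ (m i) * M ^ (s i) * (δ⁻¹ * ‖x k‖ ^ d) := by ring
        _ ≤ _ := this
    · push Not at hhit
      -- Neither case occurs, so `i` is a shrinking time: pay one factor `M` for a single step, and
      -- the count `s` drops by one.
      have hS : Shrinks d τ η x (η * δ) k i := fun j h1 h2 => ⟨hcap' j h1 h2, hhit j h1 h2⟩
      have hxi : δ < ‖x i‖ := by
        have := hhit i le_rfl (by omega)
        rw [growth_self, mul_one] at this
        exact lt_of_mul_lt_mul_left this hη.le
      have hik : i < k := by
        rcases (show i ≤ k by omega).eq_or_lt with rfl | hlt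
        · linarith
        · exact hlt
      have h1 : M ≤ growth d (τ ^ 2) x i (i + 1) := by
        refine le_trans ?_ (h.pow_norm_le_growth_step i)
        rw [hM]; gcongr
      rw [← growth_mul (Nat.le_succ i) (show i + 1 ≤ k + 1 by omega)]
      calc κ ^ (m i) * M ^ (s i) * (‖x k‖ ^ d / δ)
          ≤ κ ^ (m (i + 1)) * M ^ (s (i + 1) + 1) * (‖x k‖ ^ d / δ) := by
            refine mul_le_mul_of_nonneg_right (hmono ?_ ?_) (by positivity)
            · exact countIco_anti _ (by omega)
            · exact countIco_succ _ le_rfl (by omega) hS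
        _ = M * (κ ^ (m (i + 1)) * M ^ (s (i + 1)) * (‖x k‖ ^ d / δ)) := by ring
        _ ≤ _ := mul_le_mul h1 (ih2 (i + 1) (by omega) (by omega) hik) (by positivity) (hG0 _ _).le

end NoncontractingOrbit

/-! ### Growth along the whole bounded orbit -/

namespace NoncontractingOrbit

variable {d : ℕ} {τ η : ℝ} {x : ℕ → ℂ}

/-- Away from `0` the disc of radius `η * δ` is never too large until it expands, so only shrinking
times cost a factor. -/
lemma pow_le_growth_of_lt_norm (h : NoncontractingOrbit d τ η x) {δ : ℝ} (hδ : 0 < δ)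
    (hδ1 : δ ≤ 1) {k : ℕ} (n : ℕ) : ∀ i, i + n = k + 1 → (∀ j, i ≤ j → j ≤ k → δ < ‖x j‖) →
      ((δ ^ (d - 1)) ^ (countIco (Shrinks d τ η x (η * δ) k) i (k + 1) + 1)
        ≤ growth d (τ ^ 2) x i (k + 1)) := by
  set M := δ ^ (d - 1) with hM
  have hη := h.eta_pos
  have hM0 : 0 < M := by positivity
  have hM1 : M ≤ 1 := pow_le_one₀ hδ.le hδ1
  have hG0 : ∀ i j, 0 ≤ growth d (τ ^ 2) x i j := growth_nonneg (sq_nonneg τ)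
  induction n using Nat.strong_induction_on with
  | _ n ih =>
  intro i hin hfar
  rcases Nat.eq_zero_or_pos n with rfl | hn
  · rw [show i = k + 1 by omega, growth_self]
    exact pow_le_one₀ hM0.le hM1
  by_cases hcap : ∃ j, i < j ∧ j ≤ k ∧ 1 < growth d (τ ^ 2) x i j
  · obtain ⟨j, hij, hjk, hj⟩ := hcap
    rw [← growth_mul hij.le (show j ≤ k + 1 by omega)]
    refine le_trans ?_ (le_mul_of_one_le_left (hG0 _ _) hj.le)
    refine le_trans ?_ (ih (k + 1 - j) (by omega) j (by omega) fun l h1 h2 => hfar l (by omega) h2)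
    exact pow_le_pow_of_le_one hM0.le hM1 (Nat.succ_le_succ (countIco_anti _ hij.le))
  have hcap' : ∀ j, i ≤ j → j ≤ k → growth d (τ ^ 2) x i j ≤ 1 := by
    intro j hij hjk
    rcases hij.eq_or_lt with rfl | hlt
    · simp
    · by_contra hc
      exact hcap ⟨j, hlt, hjk, not_le.1 hc⟩
  have hS : Shrinks d τ η x (η * δ) k i := fun j h1 h2 => ⟨hcap' j h1 h2,
    (mul_le_of_le_one_right (by positivity) (hcap' j h1 h2)).trans_lt
      (mul_lt_mul_of_pos_left (hfar j h1 h2) hη)⟩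
  have h1 : M ≤ growth d (τ ^ 2) x i (i + 1) := by
    refine le_trans ?_ (h.pow_norm_le_growth_step i)
    have := hfar i le_rfl (by omega)
    rw [hM]; gcongr
  rw [← growth_mul (Nat.le_succ i) (show i + 1 ≤ k + 1 by omega)]
  have h2 := ih (n - 1) (by omega) (i + 1) (by omega) fun l h1 h2 => hfar l (by omega) h2
  refine le_trans ?_ (mul_le_mul h1 h2 (by positivity) (hG0 _ _))
  rw [← pow_succ']
  exact pow_le_pow_of_le_one hM0.le hM1
    (Nat.succ_le_succ (countIco_succ _ le_rfl (by omega) hS))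

lemma exists_countIco_shrinks_le (h : NoncontractingOrbit d τ η x) {K : ℝ}
    (hK : ∀ j, ‖x j‖ ≤ K) {r : ℝ} (hr : 0 < r) :
    ∃ p : ℕ, ∀ k i, countIco (Shrinks d τ η x r k) i (k + 1) ≤ p := by
  obtain ⟨p, hp⟩ := exists_countIco_le_of_separated hK
    (mul_pos hr (sub_pos.2 (inv_lt_one_of_one_lt₀ h.one_lt)))
  exact ⟨p, fun k i => hp _ (k + 1) (fun a b hab ha _ hb =>
    Shrinks.lt_norm_sub h hr ha hab (by omega)) i⟩

/-- Cutting the orbit at successive closest approaches to the critical point. -/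
lemma exists_forall_le_growth (h : NoncontractingOrbit d τ η x) {K : ℝ}
    (hK : ∀ j, ‖x j‖ ≤ K) {δ : ℝ} (hδ : 0 < δ) (hδ1 : δ ≤ 1) (hδη : 4 * δ ^ (d - 1) ≤ η) :
    ∃ C, 0 < C ∧ C ≤ 1 ∧ ∀ δ', 0 < δ' → δ' ≤ δ → ∃ Q, 0 < Q ∧ ∀ n,
      (η / 4) ^ (countIco (fun j => ‖x j‖ ≤ δ) 0 n) *
        C ^ (countIco (fun j => ‖x j‖ ≤ δ') 0 n) * Q ≤ growth d (τ ^ 2) x 0 n := by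
  have hη := h.eta_pos
  have hη1 := h.eta_le_one
  obtain ⟨p, hp⟩ := h.exists_countIco_shrinks_le hK (mul_pos hη hδ)
  set κ := η / 4 with hκ
  set M := δ ^ (d - 1) with hM
  have hκ0 : 0 < κ := by positivity
  have hκ1 : κ ≤ 1 := by linarith
  have hM0 : 0 < M := by positivity
  have hM1 : M ≤ 1 := pow_le_one₀ hδ.le hδ1
  have hG0 : ∀ i j, 0 ≤ growth d (τ ^ 2) x i j := growth_nonneg (sq_nonneg τ)
  have hC0 : 0 < κ * M ^ p := by positivity
  have hC1 : κ * M ^ p ≤ 1 := mul_le_one₀ hκ1 (by positivity) (pow_le_one₀ hM0.le hM1)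
  -- This constant depends on `δ` but not on `δ'`, so `δ'` can later be chosen in terms of it.
  refine ⟨κ * M ^ p, hC0, hC1, fun δ' hδ' hle => ?_⟩
  obtain ⟨p', hp'⟩ := h.exists_countIco_shrinks_le hK (mul_pos hη hδ')
  set M' := δ' ^ (d - 1) with hM'
  have hM'0 : 0 < M' := by positivity
  have hM'1 : M' ≤ 1 := pow_le_one₀ hδ'.le (hle.trans hδ1)
  refine ⟨M' ^ (p' + 1), by positivity, fun n => ?_⟩
  -- The invariant says that `x i` is at least as close to `x 0` as every later image; a cut just
  -- after a minimum of `‖x j‖` preserves it.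
  have key : ∀ l i, i + l = n → (∀ j, i ≤ j → j < n → ‖x i - x 0‖ ≤ ‖x j‖ ^ d) →
      κ ^ (countIco (fun j => ‖x j‖ ≤ δ) i n) *
        (κ * M ^ p) ^ (countIco (fun j => ‖x j‖ ≤ δ') i n) * M' ^ (p' + 1)
        ≤ growth d (τ ^ 2) x i n := by
    intro l
    induction l using Nat.strong_induction_on with
    | _ l ih =>
    intro i hil hi
    by_cases hvis : ∃ j, i ≤ j ∧ j < n ∧ ‖x j‖ ≤ δ'
    · obtain ⟨k, hkmem, hkmin⟩ := (Finset.Ico i n).exists_min_image (fun j => ‖x j‖) (by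
        obtain ⟨j, h1, h2, -⟩ := hvis
        exact ⟨j, Finset.mem_Ico.2 ⟨h1, h2⟩⟩)
      rw [Finset.mem_Ico] at hkmem
      have hkmin' : ∀ j, i ≤ j → j < n → ‖x k‖ ≤ ‖x j‖ :=
        fun j h1 h2 => hkmin j (Finset.mem_Ico.2 ⟨h1, h2⟩)
      have hkδ' : ‖x k‖ ≤ δ' := by
        obtain ⟨j, h1, h2, h3⟩ := hvis
        exact (hkmin' j h1 h2).trans h3
      have hxk : 0 < ‖x k‖ := norm_pos_iff.2 (h.ne_zero k)
      -- Taking `t = ‖x k‖` makes the ratio `‖x k‖ / t` equal to one.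
      have h1 := (h.le_growth_of_min hδ hδ1 hδη (hkδ'.trans hle) i
        (fun j h1 h2 => hkmin' j h1 (by omega)) (k - i) i le_rfl (by omega)).1 ‖x k‖ le_rfl
        (hkδ'.trans hle) (hi k hkmem.1 hkmem.2)
      rw [div_self hxk.ne', one_pow, mul_one] at h1
      have h2 := ih (n - (k + 1)) (by omega) (k + 1) (by omega) (fun j h1 h2 => by
        rw [h.norm_succ_sub]
        have := hkmin' j (by omega) h2
        gcongr)
      rw [← growth_mul (show i ≤ k + 1 by omega) (show k + 1 ≤ n by omega)]
      refine le_trans ?_ (mul_le_mul h1 h2 (by positivity) (hG0 _ _))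
      rw [countIco_split (fun j => ‖x j‖ ≤ δ) (show i ≤ k + 1 by omega)
        (show k + 1 ≤ n by omega), pow_add κ]
      have h3 : (κ * M ^ p) ^ (countIco (fun j => ‖x j‖ ≤ δ') i n) ≤
          κ * M ^ (countIco (Shrinks d τ η x (η * δ) k) i (k + 1)) *
            (κ * M ^ p) ^ (countIco (fun j => ‖x j‖ ≤ δ') (k + 1) n) := by
        refine (pow_le_pow_of_le_one hC0.le hC1
          (countIco_succ (fun j => ‖x j‖ ≤ δ') hkmem.1 hkmem.2 hkδ')).trans ?_
        rw [pow_succ']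
        gcongr ?_ * _
        exact mul_le_mul_of_nonneg_left (pow_le_pow_of_le_one hM0.le hM1 (hp k i)) hκ0.le
      calc _ ≤ κ ^ countIco (fun j => ‖x j‖ ≤ δ) i (k + 1) *
            κ ^ countIco (fun j => ‖x j‖ ≤ δ) (k + 1) n *
            (κ * M ^ (countIco (Shrinks d τ η x (η * δ) k) i (k + 1)) *
            (κ * M ^ p) ^ (countIco (fun j => ‖x j‖ ≤ δ') (k + 1) n)) * M' ^ (p' + 1) := by
              gcongr
        _ = _ := by ring
    · push Not at hvis
      refine le_trans (mul_le_of_le_one_left (by positivity)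
        (mul_le_one₀ (pow_le_one₀ hκ0.le hκ1) (by positivity) (pow_le_one₀ hC0.le hC1))) ?_
      rcases Nat.eq_zero_or_pos l with rfl | hl
      · rw [show i = n by omega, growth_self]
        exact pow_le_one₀ hM'0.le hM'1
      · obtain ⟨k, rfl⟩ : ∃ k, n = k + 1 := ⟨n - 1, by omega⟩
        refine le_trans ?_ (h.pow_le_growth_of_lt_norm hδ' (hle.trans hδ1) l i hil
          fun j h1 h2 => hvis j h1 (by omega))
        exact pow_le_pow_of_le_one hM'0.le hM'1 (Nat.succ_le_succ (hp' k i))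
  exact key n 0 (by omega) fun j _ _ => by simp

end NoncontractingOrbit

lemma mul_pow_le_pow_of_le_div {κ σ : ℝ} (hκ : 0 < κ) (hκ1 : κ ≤ 1) (hσ : 0 < σ) (hσ1 : σ ≤ 1)
    {N m n : ℕ} (hN : σ ^ N ≤ κ) (hm : m ≤ n / N + 1) : κ * σ ^ n ≤ κ ^ m := by
  calc κ * σ ^ n ≤ κ * σ ^ (N * (n / N)) :=
        mul_le_mul_of_nonneg_left (pow_le_pow_of_le_one hσ.le hσ1 (Nat.mul_div_le n N)) hκ.le
    _ = κ * (σ ^ N) ^ (n / N) := by rw [pow_mul]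
    _ ≤ κ * κ ^ (n / N) := by gcongr
    _ = κ ^ (n / N + 1) := (pow_succ' κ _).symm
    _ ≤ κ ^ m := pow_le_pow_of_le_one hκ.le hκ1 hm

theorem NoncontractingOrbit.exists_le_growth {d : ℕ} {τ η : ℝ} {x : ℕ → ℂ}
    (h : NoncontractingOrbit d τ η x) (hd : 2 ≤ d) {K : ℝ} (hK : ∀ j, ‖x j‖ ≤ K)
    (hrec : ∀ N : ℕ, ∃ δ > 0, ∀ i l, ‖x i‖ ≤ δ → 0 < l → l < N → δ < ‖x (i + l)‖) :
    ∃ C > 0, ∀ n, C * τ⁻¹ ^ (4 * n) ≤ growth d 1 x 0 n := by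
  have hη := h.eta_pos
  have hη1 := h.eta_le_one
  have hτ0 : 0 < τ := by linarith [h.one_lt]
  have hσ0 : 0 < τ⁻¹ := inv_pos.2 hτ0
  have hσ1 : τ⁻¹ < 1 := inv_lt_one_of_one_lt₀ h.one_lt
  have hexp : ∀ κ : ℝ, 0 < κ → ∃ N : ℕ, 0 < N ∧ τ⁻¹ ^ N ≤ κ := fun κ hκ => by
    obtain ⟨N, hN⟩ := exists_pow_lt_of_lt_one hκ hσ1
    exact ⟨N + 1, N.succ_pos,
      (pow_le_pow_of_le_one hσ0.le hσ1.le (Nat.le_succ N)).trans hN.le⟩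
  have hcount : ∀ N : ℕ, 0 < N → ∀ ε : ℝ, 0 < ε → ∃ δ, 0 < δ ∧ δ ≤ ε ∧
      ∀ n, countIco (fun j => ‖x j‖ ≤ δ) 0 n ≤ n / N + 1 := by
    intro N hN ε hε
    obtain ⟨δ, hδ, hδr⟩ := hrec N
    refine ⟨min δ ε, lt_min hδ hε, min_le_right _ _, fun n => ?_⟩
    refine countIco_le_of_gap _ hN (fun i l hi hl hlN => ?_) n
    exact not_le.2 ((min_le_left _ _).trans_lt (hδr i l (hi.trans (min_le_left _ _)) hl hlN))
  -- Order of choice: `N` from `η`, then `δ`, then `C`, then `N'`, then `δ'`. Each of the two losses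
  -- is then at most a constant times `τ ^ n`.
  obtain ⟨N, hN, hNκ⟩ := hexp (η / 4) (by positivity)
  obtain ⟨δ, hδ, hδη, hδN⟩ := hcount N hN (η / 4) (by positivity)
  have hδ1 : δ ≤ 1 := by linarith
  have hδη' : 4 * δ ^ (d - 1) ≤ η := by
    have : δ ^ (d - 1) ≤ δ := pow_le_of_le_one hδ.le hδ1 (by omega)
    linarith
  obtain ⟨C, hC, hC1, hCδ⟩ := h.exists_forall_le_growth hK hδ hδ1 hδη'
  obtain ⟨N', hN', hNC⟩ := hexp C hC
  obtain ⟨δ', hδ', hδδ', hδN'⟩ := hcount N' hN' δ hδ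
  obtain ⟨Q, hQ, hQn⟩ := hCδ δ' hδ' hδδ'
  refine ⟨η / 4 * C * Q, by positivity, fun n => ?_⟩
  have h1 := hQn n
  rw [growth_eq_pow_mul, Nat.sub_zero] at h1
  have h2 := mul_pow_le_pow_of_le_div (by positivity) (by linarith) hσ0 hσ1.le hNκ (hδN n)
  have h3 := mul_pow_le_pow_of_le_div hC hC1 hσ0 hσ1.le hNC (hδN' n)
  have h4 : (η / 4 * τ⁻¹ ^ n) * (C * τ⁻¹ ^ n) * Q ≤ (τ ^ 2) ^ n * growth d 1 x 0 n := by
    refine le_trans ?_ h1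
    gcongr
  have h5 : (0 : ℝ) < (τ ^ 2) ^ n := by positivity
  rw [← div_le_iff₀' h5] at h4
  refine le_trans (le_of_eq ?_) h4
  rw [eq_div_iff h5.ne', inv_pow, inv_pow, show 4 * n = n + n + 2 * n by ring, pow_add, pow_add,
    ← pow_mul]
  field_simp

/-! ### Dynamics of `z ^ d + c` -/

section dynamics

variable {d : ℕ} {c : ℂ}

lemma continuous_unicritical : Continuous (unicritical d c) := by
  unfold unicritical; fun_prop

lemma hasDerivAt_unicritical (z : ℂ) :
    HasDerivAt (unicritical d c) (d * z ^ (d - 1)) z :=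
  (hasDerivAt_pow d z).add_const c

lemma differentiable_unicritical : Differentiable ℂ (unicritical d c) :=
  fun z => (hasDerivAt_unicritical z).differentiableAt

lemma norm_deriv_unicritical_le {z : ℂ} {B : ℝ} (hz : ‖z‖ ≤ B) :
    ‖deriv (unicritical d c) z‖ ≤ d * B ^ (d - 1) := by
  rw [(hasDerivAt_unicritical z).deriv, norm_mul, norm_pow, Complex.norm_natCast]
  gcongr

lemma norm_unicritical_sub_le {u v : ℂ} {B : ℝ} (hu : ‖u‖ ≤ B) (hv : ‖v‖ ≤ B) :
    ‖unicritical d c u - unicritical d c v‖ ≤ d * B ^ (d - 1) * ‖u - v‖ :=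
  (convex_closedBall (0 : ℂ) B).norm_image_sub_le_of_norm_deriv_le
    (fun z _ => differentiable_unicritical z)
    (fun z hz => norm_deriv_unicritical_le (by simpa using hz)) (by simpa using hv)
    (by simpa using hu)

lemma deriv_iterate_succ {f : ℂ → ℂ} (hf : Differentiable ℂ f) (n : ℕ) (z : ℂ) :
    deriv f^[n + 1] z = deriv f (f^[n] z) * deriv f^[n] z := by
  rw [Function.iterate_succ']
  exact deriv_comp z (hf _) (hf.iterate n z)

lemma norm_deriv_iterate_eq_growth (n : ℕ) (z : ℂ) :
    ‖deriv (unicritical d c)^[n] z‖ = growth d 1 (fun j => (unicritical d c)^[j] z) 0 n := by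
  induction n with
  | zero => simp
  | succ n ih =>
    rw [deriv_iterate_succ differentiable_unicritical, norm_mul, ih, growth_succ (Nat.zero_le n),
      (hasDerivAt_unicritical _).deriv, norm_mul, norm_pow, Complex.norm_natCast]
    ring

/-- Discs stay round up to the factor `1 + η` as long as they are small compared with their
distance to the critical point. -/
lemma norm_iterate_sub_le_growth {η : ℝ} (hη : 0 ≤ η) (w : ℂ) {R : ℝ} (hR : 0 ≤ R) (q : ℕ)
    (h : ∀ l < q, R * growth d ((1 + η) ^ (d - 1)) (fun j => (unicritical d c)^[j] w) 0 l
      ≤ η * ‖(unicritical d c)^[l] w‖) :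
    (∀ y ∈ Metric.closedBall w R, ∀ z ∈ Metric.closedBall w R,
      ‖(unicritical d c)^[q] y - (unicritical d c)^[q] z‖ ≤
        growth d ((1 + η) ^ (d - 1)) (fun j => (unicritical d c)^[j] w) 0 q * ‖y - z‖) ∧
    ∀ y ∈ Metric.closedBall w R, ‖deriv (unicritical d c)^[q] y‖ ≤
        growth d ((1 + η) ^ (d - 1)) (fun j => (unicritical d c)^[j] w) 0 q := by
  set f := unicritical d c
  set g := growth d ((1 + η) ^ (d - 1)) (fun j => f^[j] w) with hg
  have hg0 : ∀ l, 0 ≤ g 0 l := growth_nonneg (by positivity) 0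
  induction q with
  | zero => simp [hg]
  | succ q ih =>
    obtain ⟨ih1, ih2⟩ := ih fun l hl => h l (by omega)
    have hpos : ∀ y ∈ Metric.closedBall w R, ‖f^[q] y‖ ≤ (1 + η) * ‖f^[q] w‖ := by
      intro y hy
      have h1 := ih1 y hy w (Metric.mem_closedBall_self hR)
      have h2 : ‖y - w‖ ≤ R := by simpa [dist_eq_norm] using hy
      have h3 := norm_sub_norm_le (f^[q] y) (f^[q] w)
      have h4 := h q (Nat.lt_succ_self q)
      have h5 : g 0 q * ‖y - w‖ ≤ R * g 0 q := by
        rw [mul_comm]; exact mul_le_mul_of_nonneg_right h2 (hg0 q)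
      linarith
    have hsucc : g 0 (q + 1) = d * ((1 + η) * ‖f^[q] w‖) ^ (d - 1) * g 0 q := by
      rw [hg, growth_succ (Nat.zero_le q), mul_pow]; ring
    rw [hsucc]
    constructor
    · intro y hy z hz
      rw [Function.iterate_succ_apply', Function.iterate_succ_apply', mul_assoc]
      exact (norm_unicritical_sub_le (hpos y hy) (hpos z hz)).trans
        (mul_le_mul_of_nonneg_left (ih1 y hy z hz) (by positivity))
    · intro y hy
      rw [deriv_iterate_succ differentiable_unicritical, norm_mul]
      exact mul_le_mul (norm_deriv_unicritical_le (hpos y hy)) (ih2 y hy) (norm_nonneg _)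
        (by positivity)

/-- Convergence of the `q`-th iterates passes by continuity to each residue class modulo `q`; there
are finitely many. -/
lemma mem_basin_of_tendsto {f : ℂ → ℂ} (hf : Continuous f) {p z : ℂ} {q i : ℕ} (hq : 0 < q)
    (h : Tendsto (fun n => (f^[q])^[n] (f^[i] z)) atTop (𝓝 p)) :
    z ∈ basin f (Set.range fun k : ℕ => f^[k] p) := by
  set O := Set.range fun k : ℕ => f^[k] p
  show Tendsto (fun k : ℕ => Metric.infDist (f^[k] z) O) atTop (𝓝 0)
  have hb : ∀ b : ℕ, Tendsto (fun n => Metric.infDist (f^[b + q * n + i] z) O) atTop (𝓝 0) := by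
    intro b
    have h1 : Tendsto (fun n => f^[b + q * n + i] z) atTop (𝓝 (f^[b] p)) := by
      have := ((hf.iterate b).tendsto p).comp h
      refine this.congr fun n => ?_
      simp only [Function.comp_apply]
      rw [← Function.iterate_mul, ← Function.iterate_add_apply, ← Function.iterate_add_apply,
        add_assoc]
    have h2 := ((Metric.continuous_infDist_pt O).tendsto (f^[b] p)).comp h1
    rwa [Metric.infDist_zero_of_mem (show f^[b] p ∈ O from Set.mem_range_self b)] at h2
  rw [Metric.tendsto_atTop]
  intro ε hε
  have hall : ∀ᶠ n in atTop, ∀ b ∈ Finset.range q,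
      dist (Metric.infDist (f^[b + q * n + i] z) O) 0 < ε :=
    (Filter.eventually_all_finset _).2 fun b _ => (Metric.tendsto_nhds.1 (hb b)) ε hε
  obtain ⟨A, hA⟩ := eventually_atTop.1 hall
  refine ⟨q * A + i, fun k hk => ?_⟩
  have h1 := hA ((k - i) / q) ((Nat.le_div_iff_mul_le hq).2 (by rw [mul_comm]; omega))
    ((k - i) % q) (Finset.mem_range.2 (Nat.mod_lt _ hq))
  rwa [Nat.mod_add_div, Nat.sub_add_cancel (by omega)] at h1

/-- `hself` makes the disc invariant, so the contraction principle gives a fixed point attracting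
its centre; the distortion bound also controls the multiplier. -/
lemma exists_attracting_of_contracting {η : ℝ} (hη : 0 ≤ η) (z : ℂ) (i : ℕ) {q : ℕ} (hq : 0 < q)
    {R : ℝ} (hR : 0 < R)
    (h : ∀ l < q, R * growth d ((1 + η) ^ (d - 1))
      (fun j => (unicritical d c)^[j] ((unicritical d c)^[i] z)) 0 l
      ≤ η * ‖(unicritical d c)^[l] ((unicritical d c)^[i] z)‖)
    (hlt : growth d ((1 + η) ^ (d - 1))
      (fun j => (unicritical d c)^[j] ((unicritical d c)^[i] z)) 0 q < 1)
    (hself : ‖(unicritical d c)^[q] ((unicritical d c)^[i] z) - (unicritical d c)^[i] z‖ +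
      R * growth d ((1 + η) ^ (d - 1))
      (fun j => (unicritical d c)^[j] ((unicritical d c)^[i] z)) 0 q ≤ R) :
    ∃ O, IsAttractingCycle (unicritical d c) O ∧ z ∈ basin (unicritical d c) O := by
  set f := unicritical d c
  set w := f^[i] z
  set L := growth d ((1 + η) ^ (d - 1)) (fun j => f^[j] w) 0 q
  have hL0 : 0 ≤ L := growth_nonneg (by positivity) _ _
  obtain ⟨hlip, hder⟩ := norm_iterate_sub_le_growth hη w hR.le q h
  have hw : w ∈ Metric.closedBall w R := Metric.mem_closedBall_self hR.le
  have hmaps : Set.MapsTo f^[q] (Metric.closedBall w R) (Metric.closedBall w R) := by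
    intro y hy
    have h1 := hlip y hy w hw
    have h2 : ‖y - w‖ ≤ R := by simpa [dist_eq_norm] using hy
    have h3 : L * ‖y - w‖ ≤ R * L := by
      rw [mul_comm]; exact mul_le_mul_of_nonneg_right h2 hL0
    rw [Metric.mem_closedBall, dist_eq_norm]
    have h4 := norm_add_le (f^[q] y - f^[q] w) (f^[q] w - w)
    rw [sub_add_sub_cancel] at h4
    linarith
  have hcontr : ContractingWith ⟨L, hL0⟩ (hmaps.restrict f^[q] _ _) := by
    refine ⟨by exact_mod_cast hlt, LipschitzWith.of_dist_le_mul fun y y' => ?_⟩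
    rw [Subtype.dist_eq, Subtype.dist_eq, dist_eq_norm, dist_eq_norm]
    exact hlip y y.2 y' y'.2
  obtain ⟨p, hp, hfix, htend, -⟩ := hcontr.exists_fixedPoint' Metric.isClosed_closedBall.isComplete
    hmaps hw (edist_ne_top _ _)
  exact ⟨_, ⟨p, q, hq, hfix, (hder p hp).trans_lt hlt, rfl⟩,
    mem_basin_of_tendsto continuous_unicritical hq htend⟩

lemma growth_iterate_shift (q : ℝ) (f : ℂ → ℂ) (z : ℂ) (i j : ℕ) :
    growth d q (fun l => f^[l] (f^[i] z)) 0 j = growth d q (fun l => f^[l] z) i (i + j) := by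
  unfold growth
  rw [Finset.prod_Ico_eq_prod_range, Finset.prod_Ico_eq_prod_range, Nat.add_sub_cancel_left,
    Nat.sub_zero]
  refine Finset.prod_congr rfl fun l _ => ?_
  simp only
  rw [← Function.iterate_add_apply, zero_add, add_comm l i]

/-- Otherwise `0` is periodic with multiplier zero, and `c` lies on its superattracting cycle. -/
lemma iterate_ne_zero_of_not_mem_basin (hd : 2 ≤ d)
    (hc : ∀ O : Set ℂ, IsAttractingCycle (unicritical d c) O → c ∉ basin (unicritical d c) O)
    (j : ℕ) : (unicritical d c)^[j] c ≠ 0 := by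
  intro hj
  have hf0 : unicritical d c 0 = c := by simp [unicritical, show d ≠ 0 by omega]
  have hper : (unicritical d c)^[j + 1] 0 = 0 := by
    rw [Function.iterate_succ_apply, hf0, hj]
  have hder : deriv (unicritical d c)^[j + 1] 0 = 0 := by
    rw [Function.iterate_succ, deriv_comp 0 (differentiable_unicritical.iterate j _)
      (differentiable_unicritical 0), (hasDerivAt_unicritical 0).deriv,
      zero_pow (by omega), mul_zero, mul_zero]
  refine hc _ ⟨0, j + 1, j.succ_pos, hper, by rw [hder, norm_zero]; exact one_pos, rfl⟩
    (mem_basin_of_tendsto (i := j) continuous_unicritical j.succ_pos ?_)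
  rw [hj]
  refine tendsto_const_nhds.congr fun n => ?_
  exact (Function.iterate_fixed hper n).symm

lemma noncontractingOrbit_of_not_mem_basin (hd : 2 ≤ d)
    (hc : ∀ O : Set ℂ, IsAttractingCycle (unicritical d c) O → c ∉ basin (unicritical d c) O)
    {η : ℝ} (hη : 0 < η) (hη1 : η ≤ 1) :
    NoncontractingOrbit d ((1 + η) ^ (d - 1)) η (fun j => (unicritical d c)^[j] c) where
  degree_pos := by omega
  one_lt := one_lt_pow₀ (by linarith) (by omega)
  eta_pos := hη
  eta_le_one := hη1
  ne_zero := iterate_ne_zero_of_not_mem_basin hd hc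
  norm_succ_sub j := by
    rw [Function.iterate_succ_apply', Function.iterate_zero_apply, unicritical,
      add_sub_cancel_right, norm_pow]
  lt_norm_sub := by
    intro i j R hij hR hfar hle
    by_contra hcon
    push Not at hcon
    set f := unicritical d c
    set τ := (1 + η) ^ (d - 1) with hτ
    have hτ1 : 1 < τ := one_lt_pow₀ (by linarith) (by omega)
    have hτ0 : 0 < τ := by linarith
    obtain ⟨q, rfl⟩ := Nat.exists_eq_add_of_lt hij
    rw [add_assoc] at *
    set m := q + 1 with hm
    have hcomp : ∀ l, τ ^ l * growth d τ (fun j => f^[j] c) i (i + l) =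
        growth d (τ ^ 2) (fun j => f^[j] c) i (i + l) := by
      intro l
      rw [growth_eq_pow_mul (q := τ), growth_eq_pow_mul (q := τ ^ 2), Nat.add_sub_cancel_left,
        ← mul_assoc, ← pow_add, ← pow_mul τ, two_mul]
    have hg0 : ∀ l, 0 ≤ growth d τ (fun j => f^[j] c) i (i + l) :=
      fun l => growth_nonneg hτ0.le _ _
    have hle1 : ∀ l, growth d τ (fun j => f^[j] c) i (i + l) ≤
        growth d (τ ^ 2) (fun j => f^[j] c) i (i + l) := fun l => by
      rw [← hcomp]
      exact le_mul_of_one_le_left (hg0 l) (one_le_pow₀ hτ1.le)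
    -- Since `m ≥ 1`, passing from weight `τ ^ 2` to `τ` gains at least one factor `τ⁻¹`.
    have hle2 : growth d τ (fun j => f^[j] c) i (i + m) ≤
        τ⁻¹ * growth d (τ ^ 2) (fun j => f^[j] c) i (i + m) := by
      rw [← hcomp, le_inv_mul_iff₀ hτ0]
      refine mul_le_mul_of_nonneg_right ?_ (hg0 m)
      exact le_self_pow₀ hτ1.le (by omega)
    have hlt : growth d τ (fun j => f^[j] c) i (i + m) < 1 := by
      refine hle2.trans_lt ?_
      refine (mul_le_of_le_one_right (inv_nonneg.2 hτ0.le) hle).trans_lt ?_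
      exact inv_lt_one_of_one_lt₀ hτ1
    obtain ⟨O, hO, hcO⟩ := exists_attracting_of_contracting (d := d) (c := c) hη.le c i
      (q := m) (by omega) hR
      (fun l hl => by
        rw [growth_iterate_shift, ← Function.iterate_add_apply, add_comm l i]
        exact (mul_le_mul_of_nonneg_left (hle1 l) hR.le).trans
          (hfar (i + l) (by omega) (by omega)))
      (by rw [growth_iterate_shift]; exact hlt)
      (by
        rw [growth_iterate_shift, ← Function.iterate_add_apply, add_comm m i]
        have := mul_le_mul_of_nonneg_left hle2 hR.le
        linarith)
    exact hc O hO hcO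

/-- Deep returns to the critical point are far apart in time unless `0` is periodic. -/
lemma exists_pos_forall_lt_norm_iterate (hd : d ≠ 0)
    (hne : ∀ j, (unicritical d c)^[j] c ≠ 0) (N : ℕ) :
    ∃ δ > 0, ∀ z : ℂ, ∀ l, ‖z‖ ≤ δ → 0 < l → l < N → δ < ‖(unicritical d c)^[l] z‖ := by
  have hf0 : unicritical d c 0 = c := by simp [unicritical, hd]
  have hpos : ∀ l, 0 < l → 0 < ‖(unicritical d c)^[l] 0‖ := by
    intro l hl
    obtain ⟨m, rfl⟩ : ∃ m, l = m + 1 := ⟨l - 1, by omega⟩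
    rw [Function.iterate_succ_apply, hf0]
    exact norm_pos_iff.2 (hne m)
  have hev : ∀ᶠ z : ℂ in 𝓝 0, ∀ l ∈ Finset.Ico 1 N,
      ‖(unicritical d c)^[l] 0‖ / 2 < ‖(unicritical d c)^[l] z‖ := by
    refine (Filter.eventually_all_finset _).2 fun l hl => ?_
    have := hpos l (Finset.mem_Ico.1 hl).1
    exact (continuous_unicritical.iterate l).norm.continuousAt.eventually_const_lt (by linarith)
  have hev' : ∀ᶠ δ : ℝ in 𝓝[>] 0, ∀ l ∈ Finset.Ico 1 N,
      δ < ‖(unicritical d c)^[l] 0‖ / 2 := by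
    refine (Filter.eventually_all_finset _).2 fun l hl => ?_
    have := hpos l (Finset.mem_Ico.1 hl).1
    exact nhdsWithin_le_nhds (eventually_lt_nhds (by linarith))
  obtain ⟨ε, hε, hball⟩ := Metric.eventually_nhds_iff.1 hev
  have hev'' : ∀ᶠ δ : ℝ in 𝓝[>] 0, δ < ε := nhdsWithin_le_nhds (eventually_lt_nhds hε)
  obtain ⟨δ, ⟨h1, h2⟩, h3⟩ := ((hev'.and hev'').and self_mem_nhdsWithin).exists
  refine ⟨δ, h3, fun z l hz hl hlN => ?_⟩
  have hl' := Finset.mem_Ico.2 ⟨hl, hlN⟩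
  exact (h1 l hl').trans (hball (by simpa using hz.trans_lt h2) l hl')

/-! ### From derivative bounds to the exponent -/

lemma zero_le_lowerLyapunovExponent {f : ℂ → ℂ} {z : ℂ}
    (h : ∀ σ : ℝ, 0 < σ → σ < 1 → ∃ C > 0, ∀ᶠ n in atTop, C * σ ^ n ≤ ‖deriv f^[n] z‖) :
    0 ≤ lowerLyapunovExponent f z := by
  refine le_of_forall_lt fun y hy => ?_
  obtain ⟨r, hyr, hr⟩ := EReal.lt_iff_exists_real_btwn.1 hy
  have hr0 : r < 0 := by exact_mod_cast hr
  refine hyr.trans_le (le_liminf_of_le (by isBoundedDefault) ?_)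
  -- Half of `r` goes to the exponential rate, the other half absorbs `log C / n`.
  obtain ⟨C, hC, hev⟩ := h (Real.exp (r / 2)) (Real.exp_pos _)
    (by rw [Real.exp_lt_one_iff]; linarith)
  have hlim : Tendsto (fun n : ℕ => Real.log C / (n : ℝ)) atTop (𝓝 0) :=
    tendsto_const_div_atTop_nhds_zero_nat _
  filter_upwards [hev, hlim.eventually_const_lt (show r / 2 < 0 by linarith),
    eventually_gt_atTop 0] with n hn hlog hn0
  have hn0' : (0 : ℝ) < n := by exact_mod_cast hn0
  have hpos : 0 < C * Real.exp (r / 2) ^ n := by positivity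
  rw [← ofReal_norm, ENNReal.log_ofReal_of_pos (hpos.trans_le hn), ← EReal.coe_mul,
    EReal.coe_le_coe_iff, one_div, le_inv_mul_iff₀ hn0']
  refine le_trans ?_ (Real.log_le_log hpos hn)
  rw [Real.log_mul hC.ne' (by positivity), Real.log_pow, Real.log_exp]
  rw [lt_div_iff₀ hn0'] at hlog
  linarith

/-- Beyond modulus `2 + ‖c‖` the orbit stays there, and every further derivative factor is at least
one. -/
lemma exists_eventually_le_norm_deriv_of_unbounded (hd : 2 ≤ d)
    (hne : ∀ j, (unicritical d c)^[j] c ≠ 0)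
    (hunb : ∀ K : ℝ, ∃ j, K < ‖(unicritical d c)^[j] c‖) :
    ∃ C > 0, ∀ᶠ n in atTop, C ≤ ‖deriv (unicritical d c)^[n] c‖ := by
  obtain ⟨j, hj⟩ := hunb (2 + ‖c‖)
  set x := fun j => (unicritical d c)^[j] c with hx
  have hfar : ∀ n, j ≤ n → 2 + ‖c‖ < ‖x n‖ := by
    intro n hn
    induction n, hn using Nat.le_induction with
    | base => exact hj
    | succ n hn ih =>
      have h1 : x (n + 1) = x n ^ d + c := by
        rw [hx]; simp only [Function.iterate_succ_apply']; rfl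
      have h2 : ‖x n‖ ^ d - ‖c‖ ≤ ‖x (n + 1)‖ := by
        rw [h1, ← norm_pow, ← norm_neg c, ← sub_neg_eq_add]
        exact norm_sub_norm_le _ _
      have hc0 := norm_nonneg c
      have h3 : ‖x n‖ ^ 2 ≤ ‖x n‖ ^ d := pow_le_pow_right₀ (by linarith) hd
      nlinarith
  have hd1 : (1 : ℝ) ≤ d := by exact_mod_cast (by omega : 1 ≤ d)
  refine ⟨growth d 1 x 0 j, growth_pos (by omega) one_pos hne _ _, ?_⟩
  filter_upwards [eventually_ge_atTop j] with n hn
  rw [norm_deriv_iterate_eq_growth, ← growth_mul (Nat.zero_le j) hn]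
  refine le_mul_of_one_le_right (growth_nonneg zero_le_one _ _) ?_
  unfold growth
  have : ∏ l ∈ Finset.Ico j n, (1 : ℝ) ≤ ∏ l ∈ Finset.Ico j n, (1 * (d * ‖x l‖ ^ (d - 1))) := by
    refine Finset.prod_le_prod (fun _ _ => zero_le_one) fun l hl => ?_
    have h1 := hfar l (Finset.mem_Ico.1 hl).1
    have h2 : 1 ≤ ‖x l‖ ^ (d - 1) := one_le_pow₀ (by linarith [norm_nonneg c])
    nlinarith
  simpa using this

end dynamics

theorem theorem1 (d : ℕ) (hd : 2 ≤ d) (c : ℂ)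
    (hc : ∀ O : Set ℂ, IsAttractingCycle (unicritical d c) O → c ∉ basin (unicritical d c) O) :
    0 ≤ lowerLyapunovExponent (unicritical d c) c := by
  have hne := iterate_ne_zero_of_not_mem_basin hd hc
  refine zero_le_lowerLyapunovExponent fun σ hσ0 hσ1 => ?_
  by_cases hbdd : ∃ K : ℝ, ∀ j, ‖(unicritical d c)^[j] c‖ ≤ K
  · obtain ⟨K, hK⟩ := hbdd
    -- With `τ = (1 + η) ^ (d - 1)`, the condition `τ ^ 4 < σ⁻¹` turns the bound `τ⁻¹ ^ (4 * n)`
    -- into `σ ^ n`.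
    obtain ⟨η, ⟨hη1, hησ⟩, hη0⟩ : ∃ η : ℝ, (η ≤ 1 ∧ ((1 + η) ^ (d - 1)) ^ 4 < σ⁻¹) ∧ 0 < η := by
      have h1 : ∀ᶠ η : ℝ in 𝓝[>] 0, η ≤ 1 := nhdsWithin_le_nhds (eventually_le_nhds one_pos)
      have h2 : ∀ᶠ η : ℝ in 𝓝[>] 0, ((1 + η) ^ (d - 1)) ^ 4 < σ⁻¹ := by
        have hcont : Continuous fun η : ℝ => ((1 + η) ^ (d - 1)) ^ 4 := by fun_prop
        refine nhdsWithin_le_nhds ((hcont.tendsto 0).eventually_lt_const ?_)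
        simpa using (one_lt_inv₀ hσ0).2 hσ1
      exact ((h1.and h2).and self_mem_nhdsWithin).exists
    have horb := noncontractingOrbit_of_not_mem_basin hd hc hη0 hη1
    obtain ⟨C, hC, hCn⟩ := horb.exists_le_growth hd hK fun N => by
      obtain ⟨δ, hδ, h⟩ := exists_pos_forall_lt_norm_iterate (by omega) hne N
      refine ⟨δ, hδ, fun i l hi hl hlN => ?_⟩
      have := h _ l hi hl hlN
      rwa [← Function.iterate_add_apply, add_comm l i] at this
    refine ⟨C, hC, Eventually.of_forall fun n => ?_⟩
    rw [norm_deriv_iterate_eq_growth]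
    refine le_trans ?_ (hCn n)
    rw [pow_mul, inv_pow]
    gcongr
    rw [le_inv_comm₀ hσ0 (by positivity)]
    exact hησ.le
  · push Not at hbdd
    obtain ⟨C, hC, h⟩ := exists_eventually_le_norm_deriv_of_unbounded hd hne hbdd
    refine ⟨C, hC, h.mono fun n hn => le_trans ?_ hn⟩
    exact mul_le_of_le_one_right hC.le (pow_le_one₀ hσ0.le hσ1.le)
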